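/- Let $\mathbb K$ be a field of characteristic zero (e.g. $\mathbb R$ or $\mathbb C$) and $d\ge 0$ the number of space-time dimensions (e.g. $d=4$). Consider finitely many pairs of fields $(z_k,w_k)$, where each $z_k$ is bosonic or fermionic and $w_k$ has the opposite statistics to $z_k$, and finitely many further fields $\varphi_i$, each bosonic or fermionic. A local formal power series is a formal power series with coefficients in $\mathbb K$ in the variables $z_k,w_k,\varphi_i$ and all their derivatives $\partial_1^{m_1}\cdots\partial_d^{m_d}$; bosonic variables commute, fermionic variables anticommute, and monomials of every degree and derivative order are allowed, with no finiteness restriction. An integrated local formal power series is a local formal power series modulo total divergences $\sum_\mu \partial_\mu K_\mu$, where the $K_\mu$ are local formal power series and $\partial_\mu$ is the total derivative; denote the space of these by $\Sigma$. For each $i$ let $g_i[z,w,\varphi]$ be a local formal power series all of whose monomials have statistics opposite to $\varphi_i$ (the $g_i$ may depend on $z,w$ and their derivatives, i.e. the doublets may be coupled). Let $$ s=\int d^dx\,\sum_i g_i(x)\,\frac{\delta}{\delta\varphi_i(x)}+\int d^dx\,\sum_k w_k(x)\,\frac{\delta}{\delta z_k(x)} $$ (left derivatives) be the operator on $\Sigma$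 induced by the vector field that commutes with the $\partial_\mu$ and satisfies $s\varphi_i=g_i$, $sz_k=w_k$, $sw_k=0$. Assume that $s$ is nilpotent: $s^2=0$ on $\Sigma$. Let $\mathcal I[z,w,\varphi]\in\Sigma$ satisfy $s\mathcal I=0$, and let $\mathcal I[0,0,\varphi]\in\Sigma$ be obtained from $\mathcal I$ by setting all $z_k,w_k$ and their derivatives to zero. If $s\,\mathcal I[0,0,\varphi]=0$, then there is $\mathcal G\in\Sigma$ with $$\mathcal I[z,w,\varphi]-\mathcal I[0,0,\varphi]=s\,\mathcal G[z,w,\varphi].$$ Conversely, if such a $\mathcal G$ exists, then $s\,\mathcal I[0,0,\varphi]=0$. -/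

import Mathlib

/-! # Formal power series in commuting and anticommuting variables

`J` is a set of variables and `p a : ZMod 2` is the Grassmann parity of the variable `a`.
Over a field of characteristic zero a formal power series `f` in these variables is the same thing
as the family of its Taylor coefficients at the origin: the value of `f` at the word
`[a₁, …, aₙ]` is `(∂/∂aₙ ⋯ ∂/∂a₁ f)(0)` (left derivatives).  Exchanging two neighbouring
derivatives gives the Koszul sign.  There is no restriction on which monomials occur. -/

/-- The Koszul sign `(-1)^(x y)`. -/
def ksign (R : Type*) [CommRing R] (x y : ZMod 2) : R := if x = 1 ∧ y = 1 then -1 else 1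

section Super

variable {J : Type*} {𝕜 : Type*} [Field 𝕜]

/-- Grassmann parity of a word. -/
def wordParity (p : J → ZMod 2) (v : List J) : ZMod 2 := (v.map p).sum

/-- Left derivative `∂/∂a`, on Taylor coefficients. -/
def lderiv (a : J) (f : List J → 𝕜) : List J → 𝕜 := fun v => f (a :: v)

/-- The map multiplying the part of `f` of parity `y` by `(-1)^(x y)`. -/
def twist (p : J → ZMod 2) (x : ZMod 2) (f : List J → 𝕜) : List J → 𝕜 :=
  fun v => ksign 𝕜 x (wordParity p v) * f v

/-- Product of power series, on Taylor coefficients: `(f g)(0) = f(0) g(0)`, and the graded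
Leibniz rule `∂ₐ (f g) = (∂ₐ f) g + (-1)^(|a| |f|) f (∂ₐ g)`. -/
def superMul (p : J → ZMod 2) : (List J → 𝕜) → (List J → 𝕜) → List J → 𝕜
  | f, g, [] => f [] * g []
  | f, g, a :: v => superMul p (lderiv a f) g v + superMul p (twist p (p a) f) (lderiv a g) v

/-- The space of formal power series in the variables `J` with parities `p`. -/
def SuperSeries (𝕜 : Type*) [Field 𝕜] {J : Type*} (p : J → ZMod 2) : Submodule 𝕜 (List J → 𝕜) where
  carrier := {f | ∀ u a b v, f (u ++ a :: b :: v) = ksign 𝕜 (p a) (p b) * f (u ++ b :: a :: v)}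
  zero_mem' := by intro u a b v; simp
  add_mem' := by
    intro f g hf hg u a b v
    simp only [Pi.add_apply, hf u a b v, hg u a b v]; ring
  smul_mem' := by
    intro c f hf u a b v
    simp only [Pi.smul_apply, smul_eq_mul, hf u a b v]; ring

theorem ksign_add (x y z : ZMod 2) : ksign 𝕜 x (y + z) = ksign 𝕜 x y * ksign 𝕜 x z := by
  have h2 : ∀ t : ZMod 2, t = 0 ∨ t = 1 := by decide
  have h3 : (1 + 1 : ZMod 2) = 0 := by decide
  rcases h2 x with rfl | rfl <;> rcases h2 y with rfl | rfl <;> rcases h2 z with rfl | rfl <;>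
    simp [ksign, h3]

theorem ksign_comm (x y : ZMod 2) : ksign 𝕜 x y = ksign 𝕜 y x := by
  simp [ksign, and_comm]

theorem ksign_mul_self (x y : ZMod 2) : ksign 𝕜 x y * ksign 𝕜 x y = 1 := by
  unfold ksign; split_ifs <;> simp

theorem wordParity_cons (p : J → ZMod 2) (a : J) (v : List J) :
    wordParity p (a :: v) = p a + wordParity p v := by simp [wordParity]

theorem lderiv_mem {p : J → ZMod 2} {f : List J → 𝕜} (hf : f ∈ SuperSeries 𝕜 p) (a : J) :
    lderiv a f ∈ SuperSeries 𝕜 p := fun u b c v => hf (a :: u) b c v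

theorem twist_mem {p : J → ZMod 2} {f : List J → 𝕜} (hf : f ∈ SuperSeries 𝕜 p) (x : ZMod 2) :
    twist p x f ∈ SuperSeries 𝕜 p := by
  intro u a b v
  have h : wordParity p (u ++ a :: b :: v) = wordParity p (u ++ b :: a :: v) := by
    simp [wordParity]; ring
  simp only [twist, h, hf u a b v]; ring

theorem superMul_add_left (p : J → ZMod 2) (w : List J) : ∀ f f' g : List J → 𝕜,
    superMul p (f + f') g w = superMul p f g w + superMul p f' g w := by
  induction w with
  | nil => intro f f' g; simp [superMul, add_mul]
  | cons a v ih =>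
    intro f f' g
    have h1 : lderiv a (f + f') = lderiv a f + lderiv a f' := rfl
    have h2 : twist p (p a) (f + f') = twist p (p a) f + twist p (p a) f' := by
      ext v; simp [twist, mul_add]
    simp only [superMul, h1, h2, ih]; ring

theorem superMul_smul_left (p : J → ZMod 2) (c : 𝕜) (w : List J) : ∀ f g : List J → 𝕜,
    superMul p (c • f) g w = c * superMul p f g w := by
  induction w with
  | nil => intro f g; simp [superMul, mul_assoc]
  | cons a v ih =>
    intro f g
    have h1 : lderiv a (c • f) = c • lderiv a f := rfl
    have h2 : twist p (p a) (c • f) = c • twist p (p a) f := by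
      ext v; simp [twist]; ring
    simp only [superMul, h1, h2, ih]; ring

theorem superMul_add_right (p : J → ZMod 2) (w : List J) : ∀ f g g' : List J → 𝕜,
    superMul p f (g + g') w = superMul p f g w + superMul p f g' w := by
  induction w with
  | nil => intro f f' g; simp [superMul, mul_add]
  | cons a v ih =>
    intro f g g'
    have h1 : lderiv a (g + g') = lderiv a g + lderiv a g' := rfl
    simp only [superMul, h1, ih]; ring

theorem superMul_smul_right (p : J → ZMod 2) (c : 𝕜) (w : List J) : ∀ f g : List J → 𝕜,
    superMul p f (c • g) w = c * superMul p f g w := by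
  induction w with
  | nil => intro f g; simp [superMul]; ring
  | cons a v ih =>
    intro f g
    have h1 : lderiv a (c • g) = c • lderiv a g := rfl
    simp only [superMul, h1, ih]; ring

theorem lderiv_twist (p : J → ZMod 2) (a : J) (x : ZMod 2) (f : List J → 𝕜) :
    lderiv a (twist p x f) = ksign 𝕜 x (p a) • twist p x (lderiv a f) := by
  ext v
  simp [lderiv, twist, wordParity_cons, ksign_add]; ring

theorem twist_twist_comm (p : J → ZMod 2) (x y : ZMod 2) (f : List J → 𝕜) :
    twist p x (twist p y f) = twist p y (twist p x f) := by
  ext v; simp only [twist]; ring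

theorem lderiv_lderiv {p : J → ZMod 2} {f : List J → 𝕜} (hf : f ∈ SuperSeries 𝕜 p) (a b : J) :
    lderiv b (lderiv a f) = ksign 𝕜 (p a) (p b) • lderiv a (lderiv b f) := by
  ext v; exact hf [] a b v

theorem superMul_mem {p : J → ZMod 2} {f g : List J → 𝕜} (hf : f ∈ SuperSeries 𝕜 p)
    (hg : g ∈ SuperSeries 𝕜 p) : superMul p f g ∈ SuperSeries 𝕜 p := by
  intro u
  induction u generalizing f g with
  | nil =>
    intro a b v
    simp only [List.nil_append, superMul, lderiv_twist, superMul_smul_left]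
    rw [lderiv_lderiv hf a b, lderiv_lderiv hg a b, twist_twist_comm p (p b) (p a),
      superMul_smul_left, superMul_smul_right, ksign_comm (p b) (p a)]
    linear_combination (-superMul p (twist p (p b) (lderiv a f)) (lderiv b g) v) *
      (ksign_mul_self (𝕜 := 𝕜) (p a) (p b))
  | cons c u ih =>
    intro a b v
    simp only [List.cons_append, superMul]
    rw [ih (lderiv_mem hf c) hg a b v, ih (twist_mem hf (p c)) (lderiv_mem hg c) a b v]
    ring

open Classical in
/-- The variable `a`, as a power series. -/
noncomputable def gen (𝕜 : Type*) [Field 𝕜] {J : Type*} (p : J → ZMod 2) (a : J) :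
    SuperSeries 𝕜 p :=
  ⟨fun v => if v = [a] then 1 else 0, by
    intro u b c v
    have h1 : u ++ b :: c :: v ≠ [a] := fun h => by
      have := congrArg List.length h; simp at this; omega
    have h2 : u ++ c :: b :: v ≠ [a] := fun h => by
      have := congrArg List.length h; simp at this; omega
    simp [h1, h2]⟩

/-- The series `f` has parity `x`: only monomials of parity `x` occur in it. -/
def HasParity {p : J → ZMod 2} (f : SuperSeries 𝕜 p) (x : ZMod 2) : Prop :=
  ∀ v, f.1 v ≠ 0 → wordParity p v = x

/-- Local finiteness of a family of series: a given monomial has factors in common with only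
finitely many members of the family. -/
def LocFin {p : J → ZMod 2} (Q : J → SuperSeries 𝕜 p) : Prop :=
  ∀ w : List J, {a | ∃ v, v.Sublist w ∧ (Q a).1 v ≠ 0}.Finite

theorem superMul_ne_zero (p : J → ZMod 2) (w : List J) : ∀ f g : List J → 𝕜,
    superMul p f g w ≠ 0 → ∃ v, v.Sublist w ∧ f v ≠ 0 := by
  induction w with
  | nil => intro f g h; exact ⟨[], List.Sublist.refl _, fun h0 => h (by simp [superMul, h0])⟩
  | cons a v ih =>
    intro f g h
    by_cases h1 : superMul p (lderiv a f) g v = 0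
    · have h2 : superMul p (twist p (p a) f) (lderiv a g) v ≠ 0 := fun h2 => h (by simp [superMul, h1, h2])
      obtain ⟨u, hu, hu'⟩ := ih _ _ h2
      exact ⟨u, hu.cons a, fun h0 => hu' (by simp [twist, h0])⟩
    · obtain ⟨u, hu, hu'⟩ := ih _ _ h1
      exact ⟨a :: u, hu.cons_cons a, hu'⟩

theorem LocFin.support_finite {p : J → ZMod 2} {Q : J → SuperSeries 𝕜 p} (hQ : LocFin Q)
    (G : J → List J → 𝕜) (w : List J) :
    (Function.support fun a => superMul p (Q a).1 (G a) w).Finite :=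
  (hQ w).subset fun _ ha => superMul_ne_zero p w _ _ ha

/-- The vector field `F ↦ ∑ₐ Qₐ ∂F/∂a` with coefficients `Q`. For a locally finite family `Q` each
coefficient of the result is a finite sum. -/
noncomputable def vectorField {p : J → ZMod 2} (Q : J → SuperSeries 𝕜 p) (hQ : LocFin Q) :
    SuperSeries 𝕜 p →ₗ[𝕜] SuperSeries 𝕜 p where
  toFun F := ⟨fun w => ∑ᶠ a, superMul p (Q a).1 (lderiv a F.1) w, by
    intro u b c v
    rw [← smul_eq_mul, smul_finsum]
    exact finsum_congr fun a => superMul_mem (Q a).2 (lderiv_mem F.2 a) u b c v⟩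
  map_add' F G := by
    ext w
    change ∑ᶠ a, superMul p (Q a).1 (lderiv a F.1 + lderiv a G.1) w = _
    simp only [superMul_add_right]
    exact finsum_add_distrib (hQ.support_finite _ w) (hQ.support_finite _ w)
  map_smul' c F := by
    ext w
    change ∑ᶠ a, superMul p (Q a).1 (c • lderiv a F.1) w = c • ∑ᶠ a, superMul p (Q a).1 (lderiv a F.1) w
    simp only [superMul_smul_right]
    rw [smul_finsum]; rfl

end Super

/-! # Local series: power series in the fields and all their derivatives -/

/-- The fields: the doublets `(z k, w k)`, `k : K`, and the other variables `phi i`, `i : I`. -/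
inductive FieldVar (K I : Type*)
  | z (k : K) : FieldVar K I
  | w (k : K) : FieldVar K I
  | phi (i : I) : FieldVar K I

/-- The jet variables: `(A, m)` stands for `∂₁^(m 1) ⋯ ∂_d^(m d) A`. -/
abbrev Jet (d : ℕ) (K I : Type*) := FieldVar K I × (Fin d → ℕ)

section Local

variable {d : ℕ} {K I : Type*} {𝕜 : Type*} [Field 𝕜]

/-- Parities of the fields; `z k` and `w k` have opposite statistics. -/
def fieldParity (εz : K → ZMod 2) (εφ : I → ZMod 2) : FieldVar K I → ZMod 2
  | .z k => εz k
  | .w k => εz k + 1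
  | .phi i => εφ i

/-- Derivatives have the parity of the field. -/
def jetParity (d : ℕ) (εz : K → ZMod 2) (εφ : I → ZMod 2) (a : Jet d K I) : ZMod 2 :=
  fieldParity εz εφ a.1

/-- Local formal power series in the fields and their derivatives in `d` dimensions. -/
abbrev LocalSeries (𝕜 : Type*) [Field 𝕜] (d : ℕ) {K I : Type*} (εz : K → ZMod 2)
    (εφ : I → ZMod 2) := SuperSeries 𝕜 (jetParity d εz εφ)

variable {εz : K → ZMod 2} {εφ : I → ZMod 2}

/-- `∂_μ` of a jet variable. -/
def raise (μ : Fin d) (a : Jet d K I) : Jet d K I := (a.1, a.2 + Pi.single μ 1)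

theorem raise_injective (μ : Fin d) : Function.Injective (raise (K := K) (I := I) μ) := by
  rintro ⟨A, m⟩ ⟨B, n⟩ h
  simp only [raise, Prod.mk.injEq, add_left_inj] at h
  exact Prod.ext h.1 h.2

theorem locFin_raise (μ : Fin d) :
    LocFin fun a : Jet d K I => gen 𝕜 (jetParity d εz εφ) (raise μ a) := by
  intro w
  refine ((w.finite_toSet).preimage (raise_injective μ).injOn).subset ?_
  rintro a ⟨v, hv, hv'⟩
  have : v = [raise μ a] := by
    by_contra h; exact hv' (by simp [gen, h])
  subst this
  exact hv.subset (by simp)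

/-- The total derivative `∂_μ = ∑ₐ (∂_μ a) ∂/∂a`, the sum running over the jet variables. -/
noncomputable def totalD (μ : Fin d) : LocalSeries 𝕜 d εz εφ →ₗ[𝕜] LocalSeries 𝕜 d εz εφ :=
  vectorField (fun a => gen 𝕜 (jetParity d εz εφ) (raise μ a)) (locFin_raise μ)

/-- Inverse of `raise μ` on the jet variables containing a `∂_μ`. -/
def lower (μ : Fin d) (a : Jet d K I) : Jet d K I := (a.1, a.2 - Pi.single μ 1)

theorem lower_raise (μ : Fin d) (a : Jet d K I) : lower μ (raise μ a) = a := by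
  simp [lower, raise]

theorem raise_lower (μ : Fin d) (a : Jet d K I) (h : a.2 μ ≠ 0) : raise μ (lower μ a) = a := by
  refine Prod.ext rfl (funext fun ν => ?_)
  by_cases hν : ν = μ
  · subst hν; simp [lower, raise]; omega
  · simp [lower, raise, hν]

/-- The words obtained from a word by removing one `∂_μ` from one of its letters. -/
def lowerings (μ : Fin d) : List (Jet d K I) → List (List (Jet d K I))
  | [] => []
  | b :: v => (if b.2 μ = 0 then [] else [lower μ b :: v]) ++ (lowerings μ v).map (b :: ·)

/-- The total derivative on Taylor coefficients, in closed form. -/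
def rawD (μ : Fin d) (f : List (Jet d K I) → 𝕜) : List (Jet d K I) → 𝕜 :=
  fun w => ((lowerings μ w).map f).sum

theorem rawD_cons (μ : Fin d) (f : List (Jet d K I) → 𝕜) (c : Jet d K I) (v) :
    rawD μ f (c :: v) = (if c.2 μ = 0 then 0 else f (lower μ c :: v)) + rawD μ (lderiv c f) v := by
  simp only [rawD, lowerings]
  split_ifs <;> simp [List.map_map] <;> rfl

theorem rawD_add (μ : Fin d) (f g : List (Jet d K I) → 𝕜) :
    rawD μ (f + g) = rawD μ f + rawD μ g := by
  ext w; exact List.sum_map_add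

theorem rawD_twist (μ : Fin d) (x : ZMod 2) (f : List (Jet d K I) → 𝕜) :
    rawD μ (twist (jetParity d εz εφ) x f) = twist (jetParity d εz εφ) x (rawD μ f) := by
  have key : ∀ w : List (Jet d K I), ∀ v ∈ lowerings μ w,
      wordParity (jetParity d εz εφ) v = wordParity (jetParity d εz εφ) w := by
    intro w
    induction w with
    | nil => simp [lowerings]
    | cons b u ih =>
      intro v hv
      simp only [lowerings, List.mem_append, List.mem_map] at hv
      rcases hv with hv | ⟨t, ht, rfl⟩
      · split_ifs at hv
        · simp at hv
        · simp only [List.mem_singleton] at hv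
          subst hv; simp [wordParity_cons, jetParity, lower]
      · simp [wordParity_cons, ih t ht]
  ext w
  change _ = _ * ((lowerings μ w).map f).sum
  rw [← List.sum_map_mul_left]
  refine congrArg List.sum (List.map_congr_left fun v hv => ?_)
  rw [← key w v hv]; rfl

theorem rawD_mul (μ : Fin d) (w : List (Jet d K I)) : ∀ f g : List (Jet d K I) → 𝕜,
    rawD μ (superMul (jetParity d εz εφ) f g) w =
      superMul (jetParity d εz εφ) (rawD μ f) g w +
        superMul (jetParity d εz εφ) f (rawD μ g) w := by
  induction w with
  | nil => intro f g; simp [rawD, lowerings, superMul]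
  | cons c v ih =>
    intro f g
    have hl : ∀ f : List (Jet d K I) → 𝕜, lderiv c (rawD μ f) =
        (if c.2 μ = 0 then (0 : 𝕜) else 1) • lderiv (lower μ c) f + rawD μ (lderiv c f) := by
      intro f; ext u; simp only [lderiv, rawD_cons]; split_ifs <;> simp [lderiv]
    have hm : ∀ c, lderiv c (superMul (jetParity d εz εφ) f g) =
        superMul (jetParity d εz εφ) (lderiv c f) g +
          superMul (jetParity d εz εφ) (twist (jetParity d εz εφ) (jetParity d εz εφ c) f)
            (lderiv c g) := fun c => rfl
    have hp : jetParity d εz εφ (lower μ c) = jetParity d εz εφ c := rfl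
    rw [rawD_cons, hm, rawD_add, Pi.add_apply, ih, ih, rawD_twist]
    simp only [superMul, hl, superMul_add_left, superMul_add_right, superMul_smul_left,
      superMul_smul_right, hp]
    split_ifs <;> simp <;> ring

theorem superMul_gen_cons {J : Type*} (p : J → ZMod 2) (b c : J) (G : List J → 𝕜) (v : List J) :
    superMul p (gen 𝕜 p b).1 G (c :: v) = (open Classical in if c = b then G v else 0) +
      ksign 𝕜 (p c) (p b) * superMul p (gen 𝕜 p b).1 (lderiv c G) v := by
  have zero : ∀ (v : List J) (G : List J → 𝕜), superMul p 0 G v = 0 := fun v G => by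
    simpa using superMul_smul_left p (0 : 𝕜) v 0 G
  have one : ∀ (v : List J) (G : List J → 𝕜),
      superMul p (fun u => if u = [] then (1 : 𝕜) else 0) G v = G v := by
    intro v
    induction v with
    | nil => intro G; simp [superMul]
    | cons a v ih =>
      intro G
      have h1 : lderiv a (fun u : List J => if u = [] then (1 : 𝕜) else 0) = 0 := by
        ext u; simp [lderiv]
      have h2 : twist p (p a) (fun u : List J => if u = [] then (1 : 𝕜) else 0) =
          fun u => if u = [] then (1 : 𝕜) else 0 := by
        ext u
        by_cases hu : u = []
        · subst hu; simp [twist, wordParity, ksign]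
        · simp [twist, hu]
      rw [superMul, h1, h2, zero, ih, zero_add]; rfl
  have h2 : twist p (p c) (gen 𝕜 p b).1 = ksign 𝕜 (p c) (p b) • (gen 𝕜 p b).1 := by
    ext u
    by_cases hu : u = [b]
    · subst hu; simp [twist, wordParity, gen]
    · simp [twist, hu, gen]
  rw [superMul, h2, superMul_smul_left]
  congr 1
  split_ifs with h
  · subst h
    rw [← one v G]; congr 1; ext u; simp [lderiv, gen]
  · rw [← zero v G]; congr 1; ext u; simp [lderiv, gen, h]

theorem totalD_apply (μ : Fin d) (w : List (Jet d K I)) : ∀ F : LocalSeries 𝕜 d εz εφ,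
    (totalD μ F).1 w = rawD μ F.1 w := by
  induction w with
  | nil =>
    intro F
    change ∑ᶠ a, superMul _ (gen 𝕜 (jetParity d εz εφ) (raise μ a)).1 (lderiv a F.1) [] = _
    simp [superMul, gen, rawD, lowerings]
  | cons c v ih =>
    intro F
    have hc := ih ⟨lderiv c F.1, lderiv_mem F.2 c⟩
    change ∑ᶠ a, superMul _ (gen 𝕜 (jetParity d εz εφ) (raise μ a)).1 (lderiv a (lderiv c F.1)) v = _ at hc
    change ∑ᶠ a, superMul _ (gen 𝕜 (jetParity d εz εφ) (raise μ a)).1 (lderiv a F.1) (c :: v) = _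
    have h1 : ∀ a : Jet d K I,
        superMul (jetParity d εz εφ) (gen 𝕜 (jetParity d εz εφ) (raise μ a)).1 (lderiv a F.1) (c :: v) =
        (open Classical in if c = raise μ a then F.1 (a :: v) else 0) +
        superMul (jetParity d εz εφ) (gen 𝕜 (jetParity d εz εφ) (raise μ a)).1 (lderiv a (lderiv c F.1)) v := by
      intro a
      have hp : jetParity d εz εφ (raise μ a) = jetParity d εz εφ a := rfl
      rw [superMul_gen_cons, lderiv_lderiv F.2 a c, superMul_smul_right, hp, ← mul_assoc,
        ksign_comm, ksign_mul_self, one_mul]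
      congr 1
      by_cases h : c = raise μ a <;> simp [h, lderiv]
    rw [finsum_congr h1, finsum_add_distrib _ ((locFin_raise μ).support_finite _ v), hc, rawD_cons]
    · congr 1
      split_ifs with h
      · refine finsum_eq_zero_of_forall_eq_zero fun a => if_neg ?_
        rintro rfl; simp [raise] at h
      · rw [finsum_eq_single _ (lower μ c), if_pos (raise_lower μ c h).symm]
        intro a ha; refine if_neg ?_
        rintro rfl; exact ha (lower_raise μ a).symm
    · refine (Set.finite_singleton (lower μ c)).subset fun a ha => ?_
      by_cases h : c = raise μ a
      · subst h; exact (lower_raise μ a).symm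
      · simp [h] at ha

theorem totalD_val (μ : Fin d) (F : LocalSeries 𝕜 d εz εφ) : (totalD μ F).1 = rawD μ F.1 :=
  funext fun w => totalD_apply μ w F

theorem lderiv_rawD (μ : Fin d) (c : Jet d K I) (f : List (Jet d K I) → 𝕜) :
    lderiv c (rawD μ f) =
      (if c.2 μ = 0 then (0 : 𝕜) else 1) • lderiv (lower μ c) f + rawD μ (lderiv c f) := by
  ext u; simp only [lderiv, rawD_cons]; split_ifs <;> simp [lderiv]

theorem rawD_smul (μ : Fin d) (r : 𝕜) (f : List (Jet d K I) → 𝕜) :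
    rawD μ (r • f) = r • rawD μ f := by
  ext w; exact List.sum_map_mul_left (lowerings μ w) f r

theorem rawD_comm (μ ν : Fin d) (w : List (Jet d K I)) : ∀ f : List (Jet d K I) → 𝕜,
    rawD μ (rawD ν f) w = rawD ν (rawD μ f) w := by
  by_cases hμν : μ = ν
  · subst hμν; intro f; rfl
  induction w with
  | nil => intro f; rfl
  | cons c v ih =>
    intro f
    have h1 : (lower μ c).2 ν = c.2 ν := by simp [lower, Ne.symm hμν]
    have h2 : (lower ν c).2 μ = c.2 μ := by simp [lower, hμν]
    have h3 : lower ν (lower μ c) = lower μ (lower ν c) := by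
      simp only [lower]; rw [tsub_right_comm]
    simp only [rawD_cons, lderiv_rawD, rawD_add, rawD_smul, Pi.add_apply, Pi.smul_apply, h1, h2, h3,
      ih, smul_eq_mul]
    split_ifs <;> (simp; try ring)

theorem totalD_commute (μ ν : Fin d) :
    Commute (totalD (𝕜 := 𝕜) (εz := εz) (εφ := εφ) μ : Module.End 𝕜 _) (totalD ν) := by
  refine LinearMap.ext fun F => Subtype.ext ?_
  change (totalD μ (totalD ν F)).1 = (totalD ν (totalD μ F)).1
  simp only [totalD_val]
  exact funext fun w => rawD_comm μ ν w F.1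

theorem totalD_pairwise (m : Fin d → ℕ) (s : Finset (Fin d)) :
    (s : Set (Fin d)).Pairwise (Function.onFun Commute fun μ =>
      (totalD μ : Module.End 𝕜 (LocalSeries 𝕜 d εz εφ)) ^ m μ) :=
  fun μ _ ν _ _ => (totalD_commute μ ν).pow_pow _ _

/-- The iterated total derivative `∂₁^(m 1) ⋯ ∂_d^(m d)`. -/
noncomputable def multiD (m : Fin d → ℕ) : Module.End 𝕜 (LocalSeries 𝕜 d εz εφ) :=
  Finset.univ.noncommProd (fun μ => (totalD μ : Module.End 𝕜 (LocalSeries 𝕜 d εz εφ)) ^ m μ)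
    (totalD_pairwise m Finset.univ)

theorem multiD_raise (μ : Fin d) (m : Fin d → ℕ) (F : LocalSeries 𝕜 d εz εφ) :
    totalD μ (multiD m F) = multiD (m + Pi.single μ 1) F := by
  have h : multiD (𝕜 := 𝕜) (εz := εz) (εφ := εφ) (m + Pi.single μ 1) =
      (totalD μ : Module.End 𝕜 (LocalSeries 𝕜 d εz εφ)) * multiD m := by
    unfold multiD
    rw [← Finset.mul_noncommProd_erase _ (Finset.mem_univ μ) _ (totalD_pairwise _ _),
      ← Finset.mul_noncommProd_erase _ (Finset.mem_univ μ) _ (totalD_pairwise m _), ← mul_assoc,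
      ← pow_succ']
    congr 1
    · simp
    · refine Finset.noncommProd_congr rfl (fun ν hν => ?_) _
      simp [Finset.ne_of_mem_erase hν]
  rw [h]; rfl

/-- Total number of derivatives in a word. -/
def wordOrder (v : List (Jet d K I)) : ℕ := (v.map fun a => ∑ μ, a.2 μ).sum

theorem wordOrder_lowerings (μ : Fin d) (w : List (Jet d K I)) :
    ∀ v ∈ lowerings μ w, wordOrder v + 1 = wordOrder w := by
  induction w with
  | nil => simp [lowerings]
  | cons b u ih =>
    intro v hv
    simp only [lowerings, List.mem_append, List.mem_map] at hv
    rcases hv with hv | ⟨t, ht, rfl⟩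
    · split_ifs at hv with hb
      · simp at hv
      · simp only [List.mem_singleton] at hv
        subst hv
        have h1 : ∑ ν, (lower μ b).2 ν + 1 = ∑ ν, b.2 ν := by
          conv_rhs => rw [← raise_lower μ b hb]
          simp [raise, Finset.sum_add_distrib]
        simp only [wordOrder, List.map_cons, List.sum_cons]
        omega
    · have := ih t ht
      simp only [wordOrder, List.map_cons, List.sum_cons] at this ⊢
      omega

theorem multiD_eq_zero (m : Fin d → ℕ) (F : LocalSeries 𝕜 d εz εφ) (w : List (Jet d K I))
    (hw : wordOrder w < ∑ μ, m μ) : (multiD m F).1 w = 0 := by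
  have h1 : ∀ (μ : Fin d) (n : ℕ) (G : LocalSeries 𝕜 d εz εφ), (∀ w, wordOrder w < n → G.1 w = 0) →
      ∀ w, wordOrder w < n + 1 → (totalD μ G).1 w = 0 := by
    intro μ n G hG w hw
    rw [totalD_val]
    refine List.sum_eq_zero fun x hx => ?_
    obtain ⟨v, hv, rfl⟩ := List.mem_map.1 hx
    have := wordOrder_lowerings μ w v hv
    exact hG v (by omega)
  have h2 : ∀ (μ : Fin d) (k n : ℕ) (G : LocalSeries 𝕜 d εz εφ),
      (∀ w, wordOrder w < n → G.1 w = 0) →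
      ∀ w, wordOrder w < n + k →
        (((totalD μ : Module.End 𝕜 (LocalSeries 𝕜 d εz εφ)) ^ k) G).1 w = 0 := by
    intro μ k n G hG
    induction k with
    | zero => simpa using hG
    | succ k ih => rw [pow_succ']; exact h1 μ _ _ ih
  have h3 : ∀ s : Finset (Fin d), ∀ w, wordOrder w < ∑ μ ∈ s, m μ →
      ((s.noncommProd (fun μ => (totalD μ : Module.End 𝕜 (LocalSeries 𝕜 d εz εφ)) ^ m μ)
        (totalD_pairwise m s)) F).1 w = 0 := by
    intro s
    induction s using Finset.induction_on with
    | empty => simp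
    | insert μ s hμ ih =>
      rw [Finset.noncommProd_insert_of_notMem _ _ _ _ hμ, Finset.sum_insert hμ, add_comm]
      exact h2 μ _ _ _ ih
  exact h3 Finset.univ w hw

/-- The variation of each field under the differential `s` with `s z = w`, `s w = 0`,
`s (phi i) = g i`. -/
noncomputable def variation (g : I → LocalSeries 𝕜 d εz εφ) : FieldVar K I → LocalSeries 𝕜 d εz εφ
  | .z k => gen 𝕜 (jetParity d εz εφ) (.w k, 0)
  | .w _ => 0
  | .phi i => g i

theorem locFin_variation [Finite K] [Finite I] (g : I → LocalSeries 𝕜 d εz εφ) :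
    LocFin fun a : Jet d K I => multiD a.2 (variation g a.1) := by
  intro w
  have hfin : Finite (FieldVar K I) := by
    refine Finite.of_surjective
      (fun x : K ⊕ K ⊕ I => Sum.elim FieldVar.z (Sum.elim FieldVar.w FieldVar.phi) x) ?_
    rintro (k | k | i)
    · exact ⟨.inl k, rfl⟩
    · exact ⟨.inr (.inl k), rfl⟩
    · exact ⟨.inr (.inr i), rfl⟩
  refine ((Set.finite_univ (α := FieldVar K I)).prod
    (Set.finite_Iic (fun _ : Fin d => wordOrder w))).subset ?_
  rintro ⟨A, m⟩ ⟨v, hv, hv'⟩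
  refine ⟨trivial, fun μ => ?_⟩
  have h1 : ∑ μ, m μ ≤ wordOrder v := by
    by_contra h; exact hv' (multiD_eq_zero m _ v (by omega))
  have h2 : wordOrder v ≤ wordOrder w := (hv.map _).sum_le_sum (by simp)
  exact (Finset.single_le_sum (fun ν _ => Nat.zero_le (m ν)) (Finset.mem_univ μ)).trans (h1.trans h2)

/-- The differential `s = ∑_A ∑_m (∂^m (s A)) ∂/∂(∂^m A)` on local series, `A` running over the
fields, with `s z = w`, `s w = 0`, `s (phi i) = g i`. -/
noncomputable def localDiff [Finite K] [Finite I] (g : I → LocalSeries 𝕜 d εz εφ) :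
    LocalSeries 𝕜 d εz εφ →ₗ[𝕜] LocalSeries 𝕜 d εz εφ :=
  vectorField (fun a => multiD a.2 (variation g a.1)) (locFin_variation g)

theorem localDiff_totalD [Finite K] [Finite I] (g : I → LocalSeries 𝕜 d εz εφ) (μ : Fin d)
    (F : LocalSeries 𝕜 d εz εφ) : localDiff g (totalD μ F) = totalD μ (localDiff g F) := by
  refine Subtype.ext (funext fun w => ?_)
  rw [totalD_val]
  set p := jetParity (K := K) (I := I) d εz εφ with hp
  set Q : Jet d K I → LocalSeries 𝕜 d εz εφ := fun a => multiD a.2 (variation g a.1) with hQdef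
  have hQ : LocFin Q := locFin_variation g
  have hraise : ∀ a, rawD μ (Q a).1 = (Q (raise μ a)).1 := fun a => by
    rw [← totalD_val]; exact congrArg Subtype.val (multiD_raise μ a.2 _)
  have hL : (localDiff g (totalD μ F)).1 w = ∑ᶠ a, superMul p (Q a).1 (lderiv a (rawD μ F.1)) w := by
    rw [← totalD_val]; rfl
  have hR : rawD μ (localDiff g F).1 w = ∑ᶠ a, rawD μ (superMul p (Q a).1 (lderiv a F.1)) w := by
    have hl : ∀ l : List (List (Jet d K I)),
        (l.map (localDiff g F).1).sum =
          ∑ᶠ a, (l.map (superMul p (Q a).1 (lderiv a F.1))).sum ∧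
        (Function.support fun a => (l.map (superMul p (Q a).1 (lderiv a F.1))).sum).Finite := by
      intro l
      induction l with
      | nil => simp
      | cons v l ih =>
        have hv := hQ.support_finite (fun a => lderiv a F.1) v
        simp only [List.map_cons, List.sum_cons]
        refine ⟨?_, (hv.union ih.2).subset (Function.support_add _ _)⟩
        rw [finsum_add_distrib hv ih.2, ← ih.1]; rfl
    exact (hl _).1
  rw [hL, hR]
  have e1 : ∀ a, superMul p (Q a).1 (lderiv a (rawD μ F.1)) w =
      superMul p (Q a).1 ((if a.2 μ = 0 then (0 : 𝕜) else 1) • lderiv (lower μ a) F.1) w +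
      superMul p (Q a).1 (rawD μ (lderiv a F.1)) w := fun a => by
    rw [lderiv_rawD, superMul_add_right]
  have e2 : ∀ a, rawD μ (superMul p (Q a).1 (lderiv a F.1)) w =
      superMul p (Q (raise μ a)).1 (lderiv a F.1) w +
      superMul p (Q a).1 (rawD μ (lderiv a F.1)) w := fun a => by
    rw [hp, rawD_mul, hraise]
  rw [finsum_congr e1, finsum_congr e2,
    finsum_add_distrib (hQ.support_finite _ w) (hQ.support_finite _ w),
    finsum_add_distrib (((hQ w).preimage (raise_injective μ).injOn).subset fun a ha =>
      superMul_ne_zero p w _ _ ha) (hQ.support_finite _ w)]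
  congr 1
  have e3 : (Function.support fun a => superMul p (Q a).1
      ((if a.2 μ = 0 then (0 : 𝕜) else 1) • lderiv (lower μ a) F.1) w) ⊆
      Set.range (raise (K := K) (I := I) μ) := by
    intro a ha
    refine ⟨lower μ a, raise_lower μ a fun h => ha ?_⟩
    simp only [h, if_true]; rw [superMul_smul_right, zero_mul]
  rw [← finsum_mem_univ, ← finsum_mem_inter_support_eq _ (Set.range (raise (K := K) (I := I) μ))
    Set.univ (by rw [Set.univ_inter, Set.inter_eq_right.2 e3]),
    finsum_mem_range (raise_injective μ)]
  refine finsum_congr fun a => ?_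
  rw [lower_raise, superMul_smul_right]
  simp [raise, hp]

/-- The monomials without `z`, `w` and their derivatives. -/
def phiWords (d : ℕ) (K I : Type*) : Set (List (Jet d K I)) := {v | ∀ a ∈ v, ∃ i, a.1 = .phi i}

/-- `F[z, w, φ] ↦ F[0, 0, φ]`: only the monomials without `z`, `w` and their derivatives are
kept. -/
noncomputable def localRestrict : LocalSeries 𝕜 d εz εφ →ₗ[𝕜] LocalSeries 𝕜 d εz εφ where
  toFun F := ⟨(phiWords d K I).indicator F.1, by
    intro u a b v
    have h : u ++ a :: b :: v ∈ phiWords d K I ↔ u ++ b :: a :: v ∈ phiWords d K I := by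
      simp only [phiWords, Set.mem_ofPred_eq, List.mem_append, List.mem_cons]; grind
    by_cases h' : u ++ b :: a :: v ∈ phiWords d K I
    · rw [Set.indicator_of_mem h', Set.indicator_of_mem (h.2 h'), F.2 u a b v]
    · rw [Set.indicator_of_notMem h', Set.indicator_of_notMem (mt h.1 h'), mul_zero]⟩
  map_add' F G := Subtype.ext (Set.indicator_add' _ F.1 G.1)
  map_smul' c F := Subtype.ext (Set.indicator_const_smul _ c F.1)

theorem localRestrict_totalD (μ : Fin d) (F : LocalSeries 𝕜 d εz εφ) :
    localRestrict (totalD μ F) = totalD μ (localRestrict F) := by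
  have key : ∀ w : List (Jet d K I), ∀ v ∈ lowerings μ w,
      (v ∈ phiWords d K I ↔ w ∈ phiWords d K I) := by
    intro w
    induction w with
    | nil => simp [lowerings]
    | cons b u ih =>
      intro v hv
      simp only [lowerings, List.mem_append, List.mem_map] at hv
      rcases hv with hv | ⟨t, ht, rfl⟩
      · split_ifs at hv
        · simp at hv
        · simp only [List.mem_singleton] at hv
          subst hv
          simp only [phiWords, Set.mem_ofPred_eq, List.mem_cons, forall_eq_or_imp, lower]
      · have := ih t ht
        simp only [phiWords, Set.mem_ofPred_eq] at this
        simp only [phiWords, Set.mem_ofPred_eq, List.mem_cons, forall_eq_or_imp, this]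
  refine Subtype.ext (funext fun w => ?_)
  change (phiWords d K I).indicator (totalD μ F).1 w = _
  rw [totalD_val, totalD_val]
  change _ = ((lowerings μ w).map ((phiWords d K I).indicator F.1)).sum
  by_cases hw : w ∈ phiWords d K I
  · rw [Set.indicator_of_mem hw]
    refine congrArg List.sum (List.map_congr_left fun v hv => ?_)
    rw [Set.indicator_of_mem ((key w v hv).2 hw)]
  · rw [Set.indicator_of_notMem hw]
    refine (List.sum_eq_zero fun x hx => ?_).symm
    obtain ⟨v, hv, rfl⟩ := List.mem_map.1 hx
    exact Set.indicator_of_notMem (mt (key w v hv).1 hw) _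

/-! # Integrated local series -/

/-- The total divergences `∑_μ ∂_μ K_μ`. -/
noncomputable def totalDivergences (𝕜 : Type*) [Field 𝕜] (d : ℕ) {K I : Type*} (εz : K → ZMod 2)
    (εφ : I → ZMod 2) : Submodule 𝕜 (LocalSeries 𝕜 d εz εφ) :=
  ⨆ μ, LinearMap.range (totalD μ)

/-- Integrated local formal power series: local series modulo total divergences. -/
abbrev IntegratedSeries (𝕜 : Type*) [Field 𝕜] (d : ℕ) {K I : Type*} (εz : K → ZMod 2)
    (εφ : I → ZMod 2) := LocalSeries 𝕜 d εz εφ ⧸ totalDivergences 𝕜 d εz εφ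

theorem totalDivergences_le_comap (T : LocalSeries 𝕜 d εz εφ →ₗ[𝕜] LocalSeries 𝕜 d εz εφ)
    (hT : ∀ μ F, T (totalD μ F) = totalD μ (T F)) :
    totalDivergences 𝕜 d εz εφ ≤ (totalDivergences 𝕜 d εz εφ).comap T := by
  refine iSup_le fun μ => ?_
  rintro _ ⟨F, rfl⟩
  rw [Submodule.mem_comap, hT]
  exact Submodule.mem_iSup_of_mem μ ⟨_, rfl⟩

/-- The differential `s` on integrated series, with `s z = w`, `s w = 0`, `s (phi i) = g i`:
`s ∫ F = ∫ s F`. -/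
noncomputable def integratedDiff [Finite K] [Finite I] (g : I → LocalSeries 𝕜 d εz εφ) :
    IntegratedSeries 𝕜 d εz εφ →ₗ[𝕜] IntegratedSeries 𝕜 d εz εφ :=
  Submodule.mapQ _ _ (localDiff g) (totalDivergences_le_comap _ (localDiff_totalD g))

/-- `𝓘[z, w, φ] ↦ 𝓘[0, 0, φ]` on integrated series. -/
noncomputable def setDoubletsZero (𝕜 : Type*) [Field 𝕜] (d : ℕ) {K I : Type*} (εz : K → ZMod 2)
    (εφ : I → ZMod 2) : IntegratedSeries 𝕜 d εz εφ →ₗ[𝕜] IntegratedSeries 𝕜 d εz εφ :=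
  Submodule.mapQ _ _ localRestrict (totalDivergences_le_comap _ localRestrict_totalD)

end Local

/-! Write `s` for the differential on local series and let `κ = ∑ (∂^m z k) ∂/∂(∂^m w k)` be the
contraction of the doublets. The idea is that the anticommutator `L = s κ + κ s` is invertible on
the series vanishing with the doublets, so that `κ L⁻¹` is a contracting homotopy there, although
`s φ` may contain doublets and `L` is not diagonal.

Since `κ` and `s` are odd vector fields, `L` is an even one, with `L z = z`, `L w = w` and
`L (φ i) = κ (g i)` (`doubletLaplacian_apply`). As `κ (g i)` contains at least one doublet variable,
`L` is the number of doublet variables plus an operator that raises this number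
(`doubletLaplacian_triangular`). In characteristic zero `L` can therefore be inverted recursively
on formal power series, after making it the identity on the series without doublets
(`bijective_of_triangular`, `extendedLaplacian_bijective`).

The operator `L` and its inverse commute with the total derivatives, hence preserve divergences
(`mem_totalDivergences_of_extendedLaplacian`). The condition `s² = 0` is available only modulo
divergences, but that is all that the homotopy argument uses (`exists_localDiff_primitive`): for `F`
closed and vanishing with the doublets put `G = L⁻¹ κ F`; then `L (F - s G)` is a combination of
`κ s F`, `s² κ G` and `κ s² G`, hence a divergence, and so is `F - s G`. -/

/-! ### Triangular operators on power series -/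

section Triangular

variable {J : Type*} {𝕜 : Type*} [Field 𝕜] {p : J → ZMod 2}

/-- The weighted degree of a word, the letter `a` having degree `wt a`. -/
def wordDegree (wt : J → ℕ) (v : List J) : ℕ := (v.map wt).sum

theorem wordDegree_cons (wt : J → ℕ) (a : J) (v : List J) :
    wordDegree wt (a :: v) = wt a + wordDegree wt v := by simp [wordDegree]

theorem wordDegree_swap (wt : J → ℕ) (u : List J) (a b : J) (v : List J) :
    wordDegree wt (u ++ a :: b :: v) = wordDegree wt (u ++ b :: a :: v) := by
  simp [wordDegree]; omega

/-- A product of series starting in degrees `i` and `j` starts in degree `i + j`. -/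
theorem superMul_eq_zero_of_wordDegree (p : J → ZMod 2) (wt : J → ℕ) (v : List J) :
    ∀ (i j : ℕ) (f g : List J → 𝕜), (∀ u, wordDegree wt u < i → f u = 0) →
      (∀ u, wordDegree wt u < j → g u = 0) → wordDegree wt v < i + j →
      superMul p f g v = 0 := by
  induction v with
  | nil =>
    intro i j f g hf hg hv
    rw [superMul]
    rcases Nat.eq_zero_or_pos i with rfl | hi
    · rw [hg [] (by simpa using hv), mul_zero]
    · rw [hf [] (by simpa [wordDegree] using hi), zero_mul]
  | cons a v ih =>
    intro i j f g hf hg hv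
    rw [wordDegree_cons] at hv
    -- Truncated subtraction is harmless: for `i ≤ wt a` the condition on the degree of `v` still
    -- follows.
    rw [superMul, ih (i - wt a) j (lderiv a f) g _ hg (by omega),
      ih i (j - wt a) (twist p (p a) f) (lderiv a g) _ _ (by omega), add_zero]
    · intro u hu; simp [twist, hf u hu]
    · intro u hu; exact hg _ (by rw [wordDegree_cons]; omega)
    · intro u hu; exact hf _ (by rw [wordDegree_cons]; omega)

/-- The series whose coefficients are those of `h - G`, divided by `c`, in degree `n`, and zero in
all other degrees. -/
def degreeCorrection (wt : J → ℕ) (c : 𝕜) (h G : SuperSeries 𝕜 p) (n : ℕ) : SuperSeries 𝕜 p :=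
  ⟨fun v => if wordDegree wt v = n then c⁻¹ * (h.1 v - G.1 v) else 0, by
    intro u a b v
    dsimp only
    rw [wordDegree_swap wt u a b v, h.2 u a b v, G.2 u a b v]
    split_ifs <;> ring⟩

/-- Successive approximations to a solution `F` of `T F = h`: the `n`-th one is supported in
degrees below `n`. -/
def degreeApprox (wt : J → ℕ) (c : ℕ → 𝕜) (T : SuperSeries 𝕜 p →ₗ[𝕜] SuperSeries 𝕜 p)
    (h : SuperSeries 𝕜 p) : ℕ → SuperSeries 𝕜 p
  | 0 => 0
  | n + 1 => degreeApprox wt c T h n +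
      degreeCorrection wt (c n) h (T (degreeApprox wt c T h n)) n

theorem degreeApprox_stable (wt : J → ℕ) (c : ℕ → 𝕜)
    (T : SuperSeries 𝕜 p →ₗ[𝕜] SuperSeries 𝕜 p) (h : SuperSeries 𝕜 p) (v : List J) {n : ℕ}
    (hn : wordDegree wt v < n) : (degreeApprox wt c T h n).1 v =
      (degreeApprox wt c T h (wordDegree wt v + 1)).1 v := by
  induction n, hn using Nat.le_induction with
  | base => rfl
  | succ n hn ih =>
    rw [← ih]
    change (degreeApprox wt c T h n).1 v + (if _ then _ else _) = _
    rw [if_neg (by omega), add_zero]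

/-- An operator which is multiplication by a nonzero constant `c n` in degree `n`, up to
contributions from lower degrees, is bijective: `T F = h` is solved degree by degree, and no
convergence question arises because a coefficient is fixed after finitely many steps. -/
theorem bijective_of_triangular (wt : J → ℕ) (c : ℕ → 𝕜) (hc : ∀ n, c n ≠ 0)
    (T : SuperSeries 𝕜 p →ₗ[𝕜] SuperSeries 𝕜 p)
    (hT : ∀ F v, (∀ u, wordDegree wt u < wordDegree wt v → F.1 u = 0) →
      (T F).1 v = c (wordDegree wt v) * F.1 v) : Function.Bijective T := by
  refine ⟨(injective_iff_map_eq_zero T).2 fun F hF => ?_, fun h => ?_⟩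
  · have key : ∀ n v, wordDegree wt v = n → F.1 v = 0 := by
      intro n
      induction n using Nat.strong_induction_on with
      | _ n ih =>
        intro v hv
        have h1 := hT F v fun u hu => ih _ (hv ▸ hu) u rfl
        rw [hF] at h1
        exact (mul_eq_zero.1 h1.symm).resolve_left (hc _)
    exact Subtype.ext (funext fun v => key _ v rfl)
  · have approx : ∀ n v, wordDegree wt v < n → (T (degreeApprox wt c T h n)).1 v = h.1 v := by
      intro n
      induction n with
      | zero => intro v hv; omega
      | succ n ih =>
        intro v hv
        change (T (_ + degreeCorrection wt (c n) h (T (degreeApprox wt c T h n)) n)).1 v = _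
        rw [map_add]
        change (T (degreeApprox wt c T h n)).1 v + (T (degreeCorrection _ _ _ _ _)).1 v = _
        rw [hT (degreeCorrection _ _ _ _ _) v fun u hu => if_neg (by omega)]
        change _ + _ * (if _ then _ else _) = _
        split_ifs with hvn
        · rw [hvn, mul_inv_cancel_left₀ (hc n)]; ring
        · rw [ih v (by omega)]; ring
    let F : SuperSeries 𝕜 p :=
      ⟨fun v => (degreeApprox wt c T h (wordDegree wt v + 1)).1 v, by
        intro u a b v
        dsimp only
        rw [wordDegree_swap wt u a b v]
        exact (degreeApprox wt c T h _).2 u a b v⟩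
    refine ⟨F, Subtype.ext (funext fun v => ?_)⟩
    set A := degreeApprox wt c T h (wordDegree wt v + 1) with hA
    have hFA : ∀ u, wordDegree wt u < wordDegree wt v + 1 → (F - A).1 u = 0 := fun u hu =>
      sub_eq_zero.2 (degreeApprox_stable wt c T h u hu).symm
    have h1 := hT (F - A) v fun u hu => hFA u (by omega)
    rw [hFA v (by omega), mul_zero, map_sub] at h1
    rw [← approx (wordDegree wt v + 1) v (by omega)]
    exact sub_eq_zero.1 h1

/-- The operator `b ∂/∂b` counts the occurrences of `b`. -/
theorem superMul_gen_lderiv [DecidableEq J] (b : J) (v : List J) : ∀ F ∈ SuperSeries 𝕜 p,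
    superMul p (gen 𝕜 p b).1 (lderiv b F) v = (v.count b : 𝕜) * F v := by
  induction v with
  | nil => intro F _; simp [superMul, gen]
  | cons c v ih =>
    intro F hF
    rw [superMul_gen_cons, lderiv_lderiv hF b c, superMul_smul_right, ← mul_assoc,
      ksign_comm (p b), ksign_mul_self, one_mul, ih _ (lderiv_mem hF c), List.count_cons]
    by_cases h : c = b
    · subst h; simp [lderiv]; ring
    · simp [h, lderiv]

end Triangular

section Local

variable {d : ℕ} {K I : Type*} {𝕜 : Type*} [Field 𝕜] {εz : K → ZMod 2} {εφ : I → ZMod 2}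

/-! ### The contracting operator -/

/-- The jet variable `∂^m w k` for `∂^m z k`; the other jet variables are left alone. -/
def doubletPartner : Jet d K I → Jet d K I
  | (.z k, m) => (.w k, m)
  | a => a

/-- The indicator function of the jet variables `∂^m z k`. -/
def zIndicator (𝕜 : Type*) [Field 𝕜] : Jet d K I → 𝕜
  | (.z _, _) => 1
  | _ => 0

/-- The odd vector field `∑ₖ ∑ₘ (∂^m z k) ∂/∂(∂^m w k)` on Taylor coefficients, given through its
graded commutator with `∂/∂c`: this is `∂/∂(∂^m w k)` for `c = ∂^m z k`, and zero for any other
variable `c`. -/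
def rawContraction (p : Jet d K I → ZMod 2) : (List (Jet d K I) → 𝕜) → List (Jet d K I) → 𝕜
  | _, [] => 0
  | f, c :: v => zIndicator 𝕜 c * f (doubletPartner c :: v) +
      ksign 𝕜 1 (p c) * rawContraction p (lderiv c f) v

theorem lderiv_rawContraction (p : Jet d K I → ZMod 2) (c : Jet d K I)
    (f : List (Jet d K I) → 𝕜) : lderiv c (rawContraction p f) =
      zIndicator 𝕜 c • lderiv (doubletPartner c) f +
        ksign 𝕜 1 (p c) • rawContraction p (lderiv c f) := rfl

theorem rawContraction_add (p : Jet d K I → ZMod 2) (v : List (Jet d K I)) :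
    ∀ f g : List (Jet d K I) → 𝕜,
      rawContraction p (f + g) v = rawContraction p f v + rawContraction p g v := by
  induction v with
  | nil => intro f g; simp [rawContraction]
  | cons c v ih =>
    intro f g
    have h : lderiv c (f + g) = lderiv c f + lderiv c g := rfl
    simp only [rawContraction, h, ih, Pi.add_apply]; ring

theorem rawContraction_smul (p : Jet d K I → ZMod 2) (r : 𝕜) (v : List (Jet d K I)) :
    ∀ f : List (Jet d K I) → 𝕜, rawContraction p (r • f) v = r * rawContraction p f v := by
  induction v with
  | nil => intro f; simp [rawContraction]
  | cons c v ih =>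
    intro f
    have h : lderiv c (r • f) = r • lderiv c f := rfl
    simp only [rawContraction, h, ih, Pi.smul_apply, smul_eq_mul]; ring

theorem ksign_zIndicator (x : ZMod 2) (c : Jet d K I) :
    zIndicator 𝕜 c * ksign 𝕜 x (jetParity d εz εφ (doubletPartner c)) =
      zIndicator 𝕜 c * (ksign 𝕜 x 1 * ksign 𝕜 x (jetParity d εz εφ c)) := by
  obtain ⟨_ | _ | _, m⟩ := c <;>
    simp [zIndicator, doubletPartner, jetParity, fieldParity, ksign_add, mul_comm]

theorem rawContraction_mem {f : List (Jet d K I) → 𝕜}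
    (hf : f ∈ SuperSeries 𝕜 (jetParity d εz εφ)) :
    rawContraction (jetParity d εz εφ) f ∈ SuperSeries 𝕜 (jetParity d εz εφ) := by
  intro u
  induction u generalizing f with
  | nil =>
    intro a b v
    simp only [List.nil_append, rawContraction, lderiv_lderiv hf a b, rawContraction_smul]
    have h1 := hf [] (doubletPartner a) b v
    have h2 := hf [] a (doubletPartner b) v
    have e1 := ksign_zIndicator (𝕜 := 𝕜) (εz := εz) (εφ := εφ) (jetParity d εz εφ b) a
    have e2 := ksign_zIndicator (𝕜 := 𝕜) (εz := εz) (εφ := εφ) (jetParity d εz εφ a) b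
    simp only [List.nil_append] at h1 h2
    simp only [lderiv, h1, h2]
    rw [ksign_comm (jetParity d εz εφ (doubletPartner a))]
    rw [ksign_comm _ 1] at e1 e2
    rw [ksign_comm (jetParity d εz εφ b) (jetParity d εz εφ a)] at e1
    have e3 := ksign_mul_self (𝕜 := 𝕜) 1 (jetParity d εz εφ a)
    linear_combination f (b :: doubletPartner a :: v) * e1 +
      ksign 𝕜 1 (jetParity d εz εφ a) * f (doubletPartner b :: a :: v) * e2 +
      zIndicator 𝕜 b * f (doubletPartner b :: a :: v) *
        ksign 𝕜 (jetParity d εz εφ a) (jetParity d εz εφ b) * e3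
  | cons c u ih =>
    intro a b v
    simp only [List.cons_append, rawContraction, ih (lderiv_mem hf c) a b v]
    rw [← List.cons_append, hf (doubletPartner c :: u) a b v, List.cons_append]
    ring

theorem rawContraction_twist (x : ZMod 2) (v : List (Jet d K I)) :
    ∀ f : List (Jet d K I) → 𝕜,
      rawContraction (jetParity d εz εφ) (twist (jetParity d εz εφ) x f) v =
        ksign 𝕜 x 1 * twist (jetParity d εz εφ) x (rawContraction (jetParity d εz εφ) f) v := by
  induction v with
  | nil => intro f; simp [rawContraction, twist]
  | cons c v ih =>
    intro f
    have e := ksign_zIndicator (𝕜 := 𝕜) (εz := εz) (εφ := εφ) x c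
    have e1 := ksign_mul_self (𝕜 := 𝕜) x 1
    simp only [rawContraction, lderiv_twist, rawContraction_smul, ih]
    simp only [twist, rawContraction, wordParity_cons, ksign_add]
    linear_combination f (doubletPartner c :: v) *
      ksign 𝕜 x (wordParity (jetParity d εz εφ) v) * e

/-- The contracting operator obeys the Leibniz rule of an odd left derivation. -/
theorem rawContraction_superMul (v : List (Jet d K I)) : ∀ f g : List (Jet d K I) → 𝕜,
    rawContraction (jetParity d εz εφ) (superMul (jetParity d εz εφ) f g) v =
      superMul (jetParity d εz εφ) (rawContraction (jetParity d εz εφ) f) g v +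
      superMul (jetParity d εz εφ) (twist (jetParity d εz εφ) 1 f)
        (rawContraction (jetParity d εz εφ) g) v := by
  induction v with
  | nil => intro f g; simp [rawContraction, superMul]
  | cons c v ih =>
    intro f g
    set p := jetParity (K := K) (I := I) d εz εφ with hp
    have h : ∀ c, lderiv c (superMul p f g) =
        superMul p (lderiv c f) g + superMul p (twist p (p c) f) (lderiv c g) := fun _ => rfl
    have hK : rawContraction p (twist p (p c) f) =
        ksign 𝕜 1 (p c) • twist p (p c) (rawContraction p f) := by
      rw [ksign_comm]; exact funext fun v => rawContraction_twist _ v f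
    have hz : zIndicator 𝕜 c • twist p (p (doubletPartner c)) f =
        zIndicator 𝕜 c • twist p 1 (twist p (p c) f) := by
      funext v
      have e := ksign_zIndicator (𝕜 := 𝕜) (εz := εz) (εφ := εφ) (wordParity p v) c
      simp only [Pi.smul_apply, smul_eq_mul, twist]
      rw [ksign_comm _ (wordParity p v), ksign_comm 1, ksign_comm (p c)]
      linear_combination f v * e
    have hz' := congrArg
      (fun F => superMul p F (lderiv (doubletPartner c) g) v) hz
    simp only [superMul_smul_left] at hz'
    have hcancel := ksign_mul_self (𝕜 := 𝕜) 1 (p c)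
    simp only [rawContraction, h, rawContraction_add, ih, superMul, lderiv_rawContraction,
      superMul_add_left, superMul_add_right, superMul_smul_left, superMul_smul_right, hK,
      lderiv_twist]
    change zIndicator 𝕜 c * (superMul p (lderiv (doubletPartner c) f) g v +
      superMul p (twist p (p (doubletPartner c)) f) (lderiv (doubletPartner c) g) v) + _ = _
    rw [twist_twist_comm p (p c) 1]
    linear_combination hz' +
      superMul p (twist p (p c) (rawContraction p f)) (lderiv c g) v * hcancel

theorem rawContraction_rawD (μ : Fin d) (v : List (Jet d K I)) :
    ∀ f : List (Jet d K I) → 𝕜,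
      rawContraction (jetParity d εz εφ) (rawD μ f) v =
        rawD μ (rawContraction (jetParity d εz εφ) f) v := by
  induction v with
  | nil => intro f; simp [rawContraction, rawD, lowerings]
  | cons c v ih =>
    intro f
    have hp : jetParity d εz εφ (lower μ c) = jetParity d εz εφ c := rfl
    have h1 : (doubletPartner c).2 = c.2 := by
      obtain ⟨_ | _ | _, m⟩ := c <;> rfl
    have h2 : doubletPartner (lower μ c) = lower μ (doubletPartner c) := by
      obtain ⟨_ | _ | _, m⟩ := c <;> rfl
    have h3 : zIndicator 𝕜 (lower μ c) = zIndicator 𝕜 c := by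
      obtain ⟨_ | _ | _, m⟩ := c <;> rfl
    simp only [rawContraction, rawD_cons, lderiv_rawD, lderiv_rawContraction, rawContraction_add,
      rawContraction_smul, rawD_add, rawD_smul, Pi.add_apply, Pi.smul_apply, smul_eq_mul, ih,
      h1, h2, h3, hp]
    split_ifs <;> ring

/-- The contracting operator may be applied termwise to a locally finite sum. -/
theorem rawContraction_finsum {α : Type*} (p : Jet d K I → ZMod 2) (v : List (Jet d K I)) :
    ∀ G : α → List (Jet d K I) → 𝕜, (∀ u, (Function.support fun a => G a u).Finite) →
      rawContraction p (fun u => ∑ᶠ a, G a u) v = ∑ᶠ a, rawContraction p (G a) v ∧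
      (Function.support fun a => rawContraction p (G a) v).Finite := by
  induction v with
  | nil => intro G _; simp [rawContraction]
  | cons c v ih =>
    intro G hG
    obtain ⟨h1, h2⟩ := ih (fun a => lderiv c (G a)) fun u => hG (c :: u)
    have h3 : (Function.support fun a => zIndicator 𝕜 c * G a (doubletPartner c :: v)).Finite :=
      (hG (doubletPartner c :: v)).subset fun a ha h => ha (by simp [h])
    have h4 : (Function.support fun a =>
        ksign 𝕜 1 (p c) * rawContraction p (lderiv c (G a)) v).Finite :=
      h2.subset fun a ha h => ha (by simp [h])
    simp only [rawContraction]
    refine ⟨?_, (h3.union h4).subset (Function.support_add _ _)⟩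
    rw [finsum_add_distrib h3 h4]
    simp only [← smul_eq_mul (a := zIndicator 𝕜 c), ← smul_eq_mul (a := ksign 𝕜 1 (p c))]
    rw [← smul_finsum, ← smul_finsum, ← h1]
    rfl

/-- The contracting operator `∑ₖ ∑ₘ (∂^m z k) ∂/∂(∂^m w k)` on local series. -/
def contraction : LocalSeries 𝕜 d εz εφ →ₗ[𝕜] LocalSeries 𝕜 d εz εφ where
  toFun F := ⟨rawContraction (jetParity d εz εφ) F.1, rawContraction_mem F.2⟩
  map_add' F G := Subtype.ext (funext fun v => rawContraction_add _ v F.1 G.1)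
  map_smul' c F := Subtype.ext (funext fun v => rawContraction_smul _ c v F.1)

theorem contraction_totalD (μ : Fin d) (F : LocalSeries 𝕜 d εz εφ) :
    contraction (totalD μ F) = totalD μ (contraction F) := by
  refine Subtype.ext (funext fun v => ?_)
  rw [totalD_val]
  change rawContraction _ (totalD μ F).1 v = _
  rw [totalD_val]
  exact rawContraction_rawD μ v F.1

/-! ### Iterated total derivatives of the variations -/

theorem multiD_zero (F : LocalSeries 𝕜 d εz εφ) : multiD 0 F = F := by
  have h : multiD (𝕜 := 𝕜) (d := d) (εz := εz) (εφ := εφ) 0 = 1 := by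
    unfold multiD
    rw [Finset.noncommProd_eq_pow_card Finset.univ _ _ 1 fun μ _ => by rw [Pi.zero_apply, pow_zero],
      one_pow]
  rw [h]; rfl

/-- Induction over multi-indices. -/
theorem multiIndex_induction {P : (Fin d → ℕ) → Prop} (zero : P 0)
    (step : ∀ m μ, P m → P (m + Pi.single μ 1)) (m : Fin d → ℕ) : P m := by
  induction h : ∑ μ, m μ generalizing m with
  | zero =>
    have : m = 0 := funext fun μ => by simpa using (Finset.sum_eq_zero_iff.1 h) μ
    exact this ▸ zero
  | succ n ih =>
    obtain ⟨μ, hμ⟩ : ∃ μ, m μ ≠ 0 := by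
      by_contra! h0; simp [h0] at h
    have hm : m - Pi.single μ 1 + Pi.single μ 1 = m := by
      funext ν
      by_cases hν : ν = μ
      · subst hν; simp; omega
      · simp [hν]
    rw [← hm] at h ⊢
    refine step _ _ (ih _ ?_)
    simpa [Finset.sum_add_distrib] using h

open Classical in
theorem gen_singleton {J : Type*} (p : J → ZMod 2) (a b : J) :
    (gen 𝕜 p a).1 [b] = if b = a then 1 else 0 := by
  by_cases h : b = a
  · subst h; simp [gen]
  · simp [gen, h]

theorem totalD_gen (μ : Fin d) (a : Jet d K I) :
    totalD μ (gen 𝕜 (jetParity d εz εφ) a) = gen 𝕜 (jetParity d εz εφ) (raise μ a) := by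
  refine Subtype.ext (funext fun v => ?_)
  rw [totalD_val]
  match v with
  | [] => simp [rawD, lowerings, gen]
  | [b] =>
    classical
    by_cases hb : b.2 μ = 0
    · have : b ≠ raise μ a := by rintro rfl; simp [raise] at hb
      simp [rawD, lowerings, gen_singleton, hb, this]
    · have : lower μ b = a ↔ b = raise μ a :=
        ⟨fun h => by rw [← h, raise_lower μ b hb], fun h => by rw [h, lower_raise]⟩
      simp [rawD, lowerings, gen_singleton, hb, this]
  | b :: c :: v =>
    have h : lderiv c (lderiv b (gen 𝕜 (jetParity d εz εφ) a).1) = 0 := by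
      funext u; simp [lderiv, gen]
    have h0 : rawD μ (0 : List (Jet d K I) → 𝕜) v = 0 :=
      List.sum_eq_zero fun x hx => by simpa using (List.mem_map.1 hx).imp fun _ h => h.2.symm
    rw [rawD_cons, rawD_cons, h, h0]
    simp [gen, lderiv]

theorem multiD_gen (A : FieldVar K I) (m : Fin d → ℕ) :
    multiD m (gen 𝕜 (jetParity d εz εφ) (A, 0)) = gen 𝕜 (jetParity d εz εφ) (A, m) := by
  induction m using multiIndex_induction with
  | zero => exact multiD_zero _
  | step m μ ih => rw [← multiD_raise, ih, totalD_gen]; rfl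

theorem HasParity.twist_eq {J : Type*} {p : J → ZMod 2} {f : SuperSeries 𝕜 p} {x : ZMod 2}
    (hf : HasParity f x) (y : ZMod 2) : twist p y f.1 = ksign 𝕜 y x • f.1 := by
  funext v
  by_cases h : f.1 v = 0
  · simp [twist, h]
  · simp [twist, hf v h]

theorem twist_multiD (x y : ZMod 2) (m : Fin d → ℕ) (F : LocalSeries 𝕜 d εz εφ)
    (hF : twist (jetParity d εz εφ) y F.1 = ksign 𝕜 y x • F.1) :
    twist (jetParity d εz εφ) y (multiD m F).1 = ksign 𝕜 y x • (multiD m F).1 := by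
  induction m using multiIndex_induction with
  | zero => rwa [multiD_zero]
  | step m μ ih =>
    rw [← multiD_raise, totalD_val, ← rawD_twist, ih]
    exact funext fun v => congrFun (rawD_smul μ _ _) v

theorem hasParity_variation {g : I → LocalSeries 𝕜 d εz εφ}
    (hg : ∀ i, HasParity (g i) (εφ i + 1)) (A : FieldVar K I) :
    HasParity (variation g A) (fieldParity εz εφ A + 1) := by
  match A with
  | .z k =>
    intro v hv
    have : v = [(.w k, 0)] := by
      by_contra h; exact hv (by simp [variation, gen, h])
    subst this
    simp [wordParity, jetParity, fieldParity]
  | .w k => exact fun v hv => absurd rfl hv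
  | .phi i => exact hg i

/-! ### The anticommutator of the differential and the contraction -/

/-- The degree of a jet variable in the doublets. -/
def doubletWeight : Jet d K I → ℕ
  | (.phi _, _) => 0
  | _ => 1

theorem mem_phiWords_iff (v : List (Jet d K I)) :
    v ∈ phiWords d K I ↔ wordDegree doubletWeight v = 0 := by
  have h : ∀ a : Jet d K I, (∃ i, a.1 = .phi i) ↔ doubletWeight a = 0 := by
    rintro ⟨_ | _ | _, m⟩ <;> simp [doubletWeight]
  simp only [phiWords, Set.mem_ofPred_eq, h, wordDegree, List.sum_eq_zero_iff, List.mem_map,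
    forall_exists_index, and_imp, forall_apply_eq_imp_iff₂]

theorem rawContraction_of_wordDegree_eq_zero (p : Jet d K I → ZMod 2) (v : List (Jet d K I)) :
    ∀ f : List (Jet d K I) → 𝕜, wordDegree doubletWeight v = 0 → rawContraction p f v = 0 := by
  induction v with
  | nil => intro f _; rfl
  | cons c v ih =>
    intro f hv
    rw [wordDegree_cons] at hv
    have hc : zIndicator 𝕜 c = 0 := by
      obtain ⟨_ | _ | _, m⟩ := c <;> simp_all [zIndicator, doubletWeight]
    rw [rawContraction, hc, ih _ (by omega)]; simp

theorem rawContraction_gen_w (p : Jet d K I → ZMod 2) (k : K) (m : Fin d → ℕ) :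
    rawContraction p (gen 𝕜 p (.w k, m)).1 = (gen 𝕜 p (.z k, m)).1 := by
  funext v
  match v with
  | [] => simp [rawContraction, gen]
  | [c] =>
    classical
    obtain ⟨_ | _ | _, n⟩ := c <;>
      simp [rawContraction, gen_singleton, zIndicator, doubletPartner]
  | b :: c :: v =>
    have h : lderiv c (lderiv b (gen 𝕜 p (.w k, m)).1) = 0 := by
      funext u; simp [lderiv, gen]
    have h0 : rawContraction p (0 : List (Jet d K I) → 𝕜) v = 0 := by
      simpa using rawContraction_smul p (0 : 𝕜) v 0
    simp only [rawContraction, h, h0]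
    simp [gen, lderiv]

/-- The degree of a word in the doublets, counted pair by pair. -/
theorem finsum_count_doublets [DecidableEq (Jet d K I)] (v : List (Jet d K I)) :
    ∑ᶠ a : Jet d K I, zIndicator 𝕜 a * ((v.count a : 𝕜) + v.count (doubletPartner a)) =
      wordDegree doubletWeight v ∧
    (Function.support fun a : Jet d K I =>
      zIndicator 𝕜 a * ((v.count a : 𝕜) + v.count (doubletPartner a))).Finite := by
  induction v with
  | nil => simp [wordDegree]
  | cons c v ih =>
    have key : ∑ᶠ a : Jet d K I, zIndicator 𝕜 a *
        ((if c = a then 1 else 0) + if c = doubletPartner a then 1 else 0) =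
          (doubletWeight c : 𝕜) ∧
        (Function.support fun a : Jet d K I => zIndicator 𝕜 a *
          ((if c = a then (1 : 𝕜) else 0) + if c = doubletPartner a then 1 else 0)).Finite := by
      obtain ⟨k | k | i, m⟩ := c
      · have h : ∀ a : Jet d K I, a ≠ (.z k, m) → zIndicator 𝕜 a *
            ((if (.z k, m) = a then (1 : 𝕜) else 0) +
              if (.z k, m) = doubletPartner a then 1 else 0) = 0 := by
          rintro ⟨_ | _ | _, n⟩ ha
          · simp [doubletPartner, Ne.symm ha]
          · simp [zIndicator]
          · simp [zIndicator]
        refine ⟨?_, (Set.finite_singleton (FieldVar.z k, m)).subset fun a ha => ?_⟩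
        · rw [finsum_eq_single _ _ h]; simp [zIndicator, doubletPartner, doubletWeight]
        · by_contra h'; exact ha (h a h')
      · have h : ∀ a : Jet d K I, a ≠ (.z k, m) → zIndicator 𝕜 a *
            ((if (.w k, m) = a then (1 : 𝕜) else 0) +
              if (.w k, m) = doubletPartner a then 1 else 0) = 0 := by
          rintro ⟨k' | _ | _, n⟩ ha
          · have : ¬ (k = k' ∧ m = n) := by rintro ⟨rfl, rfl⟩; exact ha rfl
            simp [doubletPartner, this]
          · simp [zIndicator]
          · simp [zIndicator]
        refine ⟨?_, (Set.finite_singleton (FieldVar.z k, m)).subset fun a ha => ?_⟩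
        · rw [finsum_eq_single _ _ h]; simp [zIndicator, doubletPartner, doubletWeight]
        · by_contra h'; exact ha (h a h')
      · have h : ∀ a : Jet d K I, zIndicator 𝕜 a *
            ((if (.phi i, m) = a then (1 : 𝕜) else 0) +
              if (.phi i, m) = doubletPartner a then 1 else 0) = 0 := by
          rintro ⟨_ | _ | _, n⟩ <;> simp [zIndicator, doubletPartner]
        simp [h, doubletWeight]
    have hsplit : ∀ a : Jet d K I, zIndicator 𝕜 a *
        (((c :: v).count a : 𝕜) + (c :: v).count (doubletPartner a)) =
        zIndicator 𝕜 a * ((v.count a : 𝕜) + v.count (doubletPartner a)) +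
        zIndicator 𝕜 a * ((if c = a then 1 else 0) + if c = doubletPartner a then 1 else 0) := by
      intro a
      simp only [List.count_cons, beq_iff_eq, Nat.cast_add, Nat.cast_ite, Nat.cast_one,
        Nat.cast_zero]
      ring
    simp only [hsplit]
    refine ⟨?_, (ih.2.union key.2).subset (Function.support_add _ _)⟩
    rw [finsum_add_distrib ih.2 key.2, ih.1, key.1, wordDegree_cons]
    push_cast; ring

/-- The anticommutator `s κ + κ s` of the differential with the contracting operator. -/
noncomputable def doubletLaplacian [Finite K] [Finite I] (g : I → LocalSeries 𝕜 d εz εφ) :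
    LocalSeries 𝕜 d εz εφ →ₗ[𝕜] LocalSeries 𝕜 d εz εφ :=
  localDiff g ∘ₗ contraction + contraction ∘ₗ localDiff g

theorem doubletLaplacian_totalD [Finite K] [Finite I] (g : I → LocalSeries 𝕜 d εz εφ) (μ : Fin d)
    (F : LocalSeries 𝕜 d εz εφ) :
    doubletLaplacian g (totalD μ F) = totalD μ (doubletLaplacian g F) := by
  simp [doubletLaplacian, contraction_totalD, localDiff_totalD]

/-- The anticommutator is a first order operator: the second order terms cancel because the
coefficient of `∂/∂a` in `s` has parity opposite to `a`. -/
theorem doubletLaplacian_apply [Finite K] [Finite I] (g : I → LocalSeries 𝕜 d εz εφ)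
    (hg : ∀ i, HasParity (g i) (εφ i + 1)) (F : LocalSeries 𝕜 d εz εφ) (v : List (Jet d K I)) :
    (doubletLaplacian g F).1 v = ∑ᶠ a : Jet d K I,
      (superMul (jetParity d εz εφ)
          (rawContraction (jetParity d εz εφ) (multiD a.2 (variation g a.1)).1) (lderiv a F.1) v +
        zIndicator 𝕜 a * superMul (jetParity d εz εφ) (multiD a.2 (variation g a.1)).1
          (lderiv (doubletPartner a) F.1) v) := by
  set p := jetParity (K := K) (I := I) d εz εφ with hp
  have hQ := locFin_variation g
  set Q : Jet d K I → LocalSeries 𝕜 d εz εφ := fun a => multiD a.2 (variation g a.1) with hQdef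
  obtain ⟨h1, h2⟩ := rawContraction_finsum p v (fun a => superMul p (Q a).1 (lderiv a F.1))
    fun u => hQ.support_finite _ u
  change ∑ᶠ a, superMul p (Q a).1 (lderiv a (rawContraction p F.1)) v +
    rawContraction p (fun u => ∑ᶠ a, superMul p (Q a).1 (lderiv a F.1) u) v = _
  rw [h1, ← finsum_add_distrib (hQ.support_finite _ v) h2]
  refine finsum_congr fun a => ?_
  have htw : twist p 1 (Q a).1 = ksign 𝕜 1 (p a + 1) • (Q a).1 :=
    twist_multiD _ _ _ _ ((hasParity_variation hg a.1).twist_eq 1)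
  have hk : ksign 𝕜 1 (p a + 1) = - ksign 𝕜 1 (p a) := by rw [ksign_add]; simp [ksign]
  have hmul := rawContraction_superMul v (Q a).1 (lderiv a F.1) (εz := εz) (εφ := εφ)
  rw [← hp] at hmul
  rw [hmul, htw, hk, lderiv_rawContraction, superMul_add_right,
    superMul_smul_left, superMul_smul_right, superMul_smul_right]
  ring

/-- To lowest order the anticommutator counts the doublet variables. The variation of `phi i`
contributes `κ (g i)` times a derivative with respect to `phi i`, which raises the doublet degree
because `κ (g i)` vanishes with the doublets. -/
theorem doubletLaplacian_triangular [Finite K] [Finite I] (g : I → LocalSeries 𝕜 d εz εφ)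
    (hg : ∀ i, HasParity (g i) (εφ i + 1)) (F : LocalSeries 𝕜 d εz εφ) (v : List (Jet d K I))
    (hF : ∀ u, wordDegree doubletWeight u < wordDegree doubletWeight v → F.1 u = 0) :
    (doubletLaplacian g F).1 v = wordDegree doubletWeight v * F.1 v := by
  classical
  rw [doubletLaplacian_apply g hg, ← (finsum_count_doublets (𝕜 := 𝕜) v).1, ← smul_eq_mul,
    finsum_smul]
  refine finsum_congr fun a => ?_
  obtain ⟨k | k | i, m⟩ := a
  -- The index `∂^m z k` accounts for both members of the pair; `∂^m w k` contributes nothing.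
  · simp only [variation, multiD_gen, rawContraction_gen_w, doubletPartner]
    rw [superMul_gen_lderiv _ v _ F.2, superMul_gen_lderiv _ v _ F.2]
    simp [zIndicator]; ring
  · have h : rawContraction (jetParity d εz εφ) (0 : List (Jet d K I) → 𝕜) = 0 :=
      funext fun v => by simpa using rawContraction_smul (jetParity d εz εφ) (0 : 𝕜) v 0
    have h' : superMul (jetParity d εz εφ) (0 : List (Jet d K I) → 𝕜)
        (lderiv (.w k, m) F.1) v = 0 := by
      simpa using superMul_smul_left (jetParity d εz εφ) (0 : 𝕜) v 0 (lderiv (.w k, m) F.1)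
    simp [variation, zIndicator, h, h']
  · rw [superMul_eq_zero_of_wordDegree _ doubletWeight v 1 (wordDegree doubletWeight v)]
    · simp [zIndicator]
    · exact fun u hu => rawContraction_of_wordDegree_eq_zero _ u _ (by omega)
    · exact fun u hu => hF _ (by rw [wordDegree_cons]; simpa [doubletWeight] using hu)
    · omega

/-! ### Setting the doublets to zero -/

theorem localRestrict_eq_zero_iff (F : LocalSeries 𝕜 d εz εφ) :
    localRestrict F = 0 ↔ ∀ v, wordDegree doubletWeight v = 0 → F.1 v = 0 := by
  refine ⟨fun h v hv => ?_, fun h => Subtype.ext (funext fun v => ?_)⟩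
  · have h1 := congrFun (congrArg Subtype.val h) v
    rwa [show (localRestrict F).1 v = F.1 v from
      Set.indicator_of_mem ((mem_phiWords_iff v).2 hv) _] at h1
  · exact Set.indicator_apply_eq_zero.2 fun hv => h v ((mem_phiWords_iff v).1 hv)

theorem localRestrict_localRestrict (F : LocalSeries 𝕜 d εz εφ) :
    localRestrict (localRestrict F) = localRestrict F :=
  Subtype.ext (by simp [localRestrict])

theorem localRestrict_contraction (F : LocalSeries 𝕜 d εz εφ) :
    localRestrict (contraction F) = 0 :=
  (localRestrict_eq_zero_iff _).2 fun v hv => rawContraction_of_wordDegree_eq_zero _ v _ hv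

/-- The differential maps the ideal generated by the doublets to itself. -/
theorem localRestrict_localDiff [Finite K] [Finite I] (g : I → LocalSeries 𝕜 d εz εφ)
    {F : LocalSeries 𝕜 d εz εφ} (hF : localRestrict F = 0) :
    localRestrict (localDiff g F) = 0 := by
  rw [localRestrict_eq_zero_iff] at hF ⊢
  intro v hv
  refine finsum_eq_zero_of_forall_eq_zero fun a => ?_
  obtain ⟨k | k | i, m⟩ := a
  · refine superMul_eq_zero_of_wordDegree _ doubletWeight v 1 0 _ _ (fun u hu => ?_)
      (fun u hu => by omega) (by omega)
    simp only [variation, multiD_gen]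
    refine if_neg ?_
    rintro rfl
    simp [wordDegree, doubletWeight] at hu
  · refine superMul_eq_zero_of_wordDegree _ doubletWeight v 1 0 _ _ (fun u hu => ?_)
      (fun u hu => by omega) (by omega)
    simp [variation]
  · refine superMul_eq_zero_of_wordDegree _ doubletWeight v 0 1 _ _ (fun u hu => by omega)
      (fun u hu => hF _ ?_) (by omega)
    rw [wordDegree_cons]
    simp only [doubletWeight]; omega

/-- The anticommutator, made invertible by letting it act as the identity on the series without
doublets. -/
noncomputable def extendedLaplacian [Finite K] [Finite I] (g : I → LocalSeries 𝕜 d εz εφ) :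
    LocalSeries 𝕜 d εz εφ →ₗ[𝕜] LocalSeries 𝕜 d εz εφ :=
  doubletLaplacian g + localRestrict

theorem extendedLaplacian_bijective [CharZero 𝕜] [Finite K] [Finite I]
    (g : I → LocalSeries 𝕜 d εz εφ) (hg : ∀ i, HasParity (g i) (εφ i + 1)) :
    Function.Bijective (extendedLaplacian g) := by
  refine bijective_of_triangular doubletWeight (fun n => if n = 0 then (1 : 𝕜) else n)
    (fun n => ?_) _ fun F v hF => ?_
  · split_ifs with h
    · exact one_ne_zero
    · exact_mod_cast h
  · change (doubletLaplacian g F).1 v + (phiWords d K I).indicator F.1 v = _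
    rw [doubletLaplacian_triangular g hg F v hF]
    split_ifs with h
    · rw [Set.indicator_of_mem ((mem_phiWords_iff v).2 h), h]; simp
    · rw [Set.indicator_of_notMem (mt (mem_phiWords_iff v).1 h), add_zero]

theorem extendedLaplacian_totalD [Finite K] [Finite I] (g : I → LocalSeries 𝕜 d εz εφ)
    (μ : Fin d) (F : LocalSeries 𝕜 d εz εφ) :
    extendedLaplacian g (totalD μ F) = totalD μ (extendedLaplacian g F) := by
  simp [extendedLaplacian, doubletLaplacian_totalD, localRestrict_totalD]

/-- Since the inverse of the extended Laplacian commutes with the total derivatives as well,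
divergences have no other preimages than divergences. -/
theorem mem_totalDivergences_of_extendedLaplacian [CharZero 𝕜] [Finite K] [Finite I]
    (g : I → LocalSeries 𝕜 d εz εφ) (hg : ∀ i, HasParity (g i) (εφ i + 1))
    {F : LocalSeries 𝕜 d εz εφ} (hF : extendedLaplacian g F ∈ totalDivergences 𝕜 d εz εφ) :
    F ∈ totalDivergences 𝕜 d εz εφ := by
  let R := LinearEquiv.ofBijective _ (extendedLaplacian_bijective g hg)
  have hR := totalDivergences_le_comap R.symm.toLinearMap (fun μ G => by
    refine R.injective ?_
    change R (R.symm _) = extendedLaplacian g (totalD μ (R.symm G))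
    rw [extendedLaplacian_totalD, R.apply_symm_apply]
    exact congrArg (totalD μ) (R.apply_symm_apply G).symm) hF
  rwa [Submodule.mem_comap, show extendedLaplacian g F = R F from rfl,
    LinearEquiv.coe_coe, R.symm_apply_apply] at hR

/-- The homotopy argument: a series which vanishes with the doublets and is closed up to
divergences is exact up to divergences. -/
theorem exists_localDiff_primitive [CharZero 𝕜] [Finite K] [Finite I]
    (g : I → LocalSeries 𝕜 d εz εφ) (hg : ∀ i, HasParity (g i) (εφ i + 1))
    (hs : ∀ F, localDiff g (localDiff g F) ∈ totalDivergences 𝕜 d εz εφ)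
    {F : LocalSeries 𝕜 d εz εφ} (hF : localRestrict F = 0)
    (hsF : localDiff g F ∈ totalDivergences 𝕜 d εz εφ) :
    ∃ G, F - localDiff g G ∈ totalDivergences 𝕜 d εz εφ := by
  obtain ⟨G, hG⟩ := (extendedLaplacian_bijective g hg).2 (contraction F)
  have hr : ∀ H, localRestrict (doubletLaplacian g H) = 0 := fun H =>
    (localRestrict_eq_zero_iff _).2 fun v hv => by
      rw [doubletLaplacian_triangular g hg H v fun u hu => by omega, hv]; simp
  have hG0 : localRestrict G = 0 := by
    have h := congrArg localRestrict hG
    rwa [localRestrict_contraction, extendedLaplacian, LinearMap.add_apply, map_add, hr, zero_add,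
      localRestrict_localRestrict] at h
  have hLG : doubletLaplacian g G = contraction F := by
    rw [← hG, extendedLaplacian, LinearMap.add_apply, hG0, add_zero]
  refine ⟨G, mem_totalDivergences_of_extendedLaplacian g hg ?_⟩
  have hκ := totalDivergences_le_comap (𝕜 := 𝕜) (d := d) (εz := εz) (εφ := εφ) contraction
    contraction_totalD
  have hr0 : localRestrict (F - localDiff g G) = 0 := by
    rw [map_sub, hF, localRestrict_localDiff g hG0, sub_zero]
  -- With `L = s κ + κ s` and `L G = κ F` one has `s κ F = s L G = s² κ G + s κ s G`, which cancels
  -- the term `s κ s G` of `L s G = s κ s G + κ s² G`.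
  have key : extendedLaplacian g (F - localDiff g G) =
      contraction (localDiff g F) + localDiff g (localDiff g (contraction G)) -
        contraction (localDiff g (localDiff g G)) := by
    rw [extendedLaplacian, LinearMap.add_apply, hr0, add_zero, map_sub]
    have h := congrArg (localDiff g) hLG
    simp only [doubletLaplacian, LinearMap.add_apply, LinearMap.comp_apply, map_add] at h ⊢
    rw [← h]; abel
  rw [key]
  exact sub_mem (add_mem (hκ hsF) (hs _)) (hκ (hs _))

end Local

theorem lemma1 {𝕜 : Type*} [Field 𝕜] [CharZero 𝕜] (d : ℕ) {K I : Type*} [Finite K] [Finite I]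
    (εz : K → ZMod 2) (εφ : I → ZMod 2)
    (g : I → LocalSeries 𝕜 d εz εφ) (hg : ∀ i, HasParity (g i) (εφ i + 1))
    (hs : ∀ F : IntegratedSeries 𝕜 d εz εφ, integratedDiff g (integratedDiff g F) = 0)
    (𝓘 : IntegratedSeries 𝕜 d εz εφ) (h𝓘 : integratedDiff g 𝓘 = 0) :
    integratedDiff g (setDoubletsZero 𝕜 d εz εφ 𝓘) = 0 ↔
      ∃ 𝓖 : IntegratedSeries 𝕜 d εz εφ, 𝓘 - setDoubletsZero 𝕜 d εz εφ 𝓘 = integratedDiff g 𝓖 := by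
  constructor
  · intro h
    obtain ⟨F, rfl⟩ := Submodule.mkQ_surjective _ 𝓘
    have hF : localDiff g (F - localRestrict F) ∈ totalDivergences 𝕜 d εz εφ := by
      rw [map_sub]
      exact sub_mem ((Submodule.Quotient.mk_eq_zero _).1 h𝓘)
        ((Submodule.Quotient.mk_eq_zero _).1 h)
    obtain ⟨G, hG⟩ := exists_localDiff_primitive g hg
      (fun H => (Submodule.Quotient.mk_eq_zero _).1 (hs (Submodule.Quotient.mk H)))
      (by rw [map_sub, localRestrict_localRestrict, sub_self]) hF
    exact ⟨Submodule.Quotient.mk G, (Submodule.Quotient.eq _).2 hG⟩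
  · rintro ⟨𝓖, h⟩
    have h1 := congrArg (integratedDiff g) h
    rwa [map_sub, h𝓘, hs, zero_sub, neg_eq_zero] at h1
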